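/- Write $\log(x)=\ln(\max(x,e))$. Let $\mathcal X$ be a linearly ordered set, $\mathcal F$ a set of binary classifiers on $\mathcal X$, and $A$ a deterministic online learner: it has a set of states, an initial state, a classifier attached to each state (its current prediction rule), and a rule that updates the state after each labelled point. Assume that $A$ is conservative (its state does not change after a correct classification) and that it makes at most $k$ mistakes on every finite sequence labelled by some $f\in\mathcal F$. Given a sample $S=(X_i,Y_i)_{i=1}^n$, let $S^*$ be the set of its pairs sorted by the order of $\mathcal X$ (repeated pairs are listed once), and let $S^*_{\preceq x}$ consist of the pairs of $S^*$ with $X_i\preceq x$. Put $\hat f(x)=Y_j$ if $x=X_j$ for some $j$; otherwise $\hat f(x)$ is the label of $x$ given by the last classifier obtained after running $A$ on $S^*_{\preceq x}$. Let $\hat g$ be the pointwise majority vote of the three classifiers $\hat f$ built from the first $\lfloor n/3\rfloor$ elements of $S$, from the first $\lfloor 2n/3\rfloor$ elements of $S$, and from $S$. A sample compression scheme of size $k$ for $\mathcal F$ is a pair of permutation invariant maps $\kappa_n$, sending samples of size $n$ to sets of at most $k$ labelled points, and a map $\rho$, sending finite sets of labelled points to classifiers, such that for every sample $S=(x_i,f(x_i))_{i=1}^n$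 with $f\in\mathcal F$, all elements of $\kappa_n(S)$ are elements of $S$ and $\rho(\kappa_n(S))(x_i)=f(x_i)$ for all $i$. It is stable if, for every such $S$, deleting from $S$ an element that is not in $\kappa_n(S)$ does not change the compression set. (1) There is a stable sample compression scheme $(\kappa_n,\rho)$ of size $k$ for $\mathcal F$ with $\hat f=\rho(\kappa_n(S))$ for every $n$ and every sample $S$ of size $n$ labelled by some $f\in\mathcal F$. For (2) and (3) let $\mathcal X$ be a measurable space in which $\{(x,x'):x\preceq x'\}$ is measurable, let the functions in $\mathcal F$ be measurable, and let the prediction of $A$ be jointly measurable in the processed labelled sequence (of any fixed length) and the next point. Let $P$ be a probability distribution of $(X,Y)$ with $Y=f^*(X)$ almost surely for some $f^*\in\mathcal F$, let $S$ be an i.i.d. sample of size $n\ge1$ from $P$, let $0<\delta<1$, and let $R(h)=P(h(X)\ne Y)$. (2) There is a universal constant $c>0$ such that with probability at least $1-\delta$ over $S$, $$R(\hat f)\le c\,\frac{k\log(1/\delta)}{n}.$$ (3) For every $C>0$ there is a constant $c>0$ depending only on $C$ such that, if the class of all classifiers held by $A$ after processing finite sequences labelled by some $f\in\mathcal F$ has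 VC dimension $d\le Ck$, then with probability at least $1-\delta$ over $S$, $$R(\hat g)\le c\left(\frac{k\log k}{n}+\frac{\log(1/\delta)}{n}\right).$$ -/

import Mathlib

open MeasureTheory

universe u v

namespace OnlineToBatch

/-- Truncated logarithm `log x = ln (max x e)`. -/
noncomputable def tlog (x : ℝ) : ℝ := Real.log (max x (Real.exp 1))

/-! ### Online learners -/

/-- A deterministic online learner with states in `σ`: a state `s` carries the current classifier
`predict s`, and after the next labelled point is revealed the learner moves to a new state. -/
structure OnlineLearner (X : Type*) (σ : Type*) where
  init : σ
  predict : σ → X → Bool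
  update : σ → X × Bool → σ

namespace OnlineLearner

variable {X σ : Type*} (A : OnlineLearner X σ)

/-- The state reached from the initial state after processing a sequence of labelled points. -/
def run (l : List (X × Bool)) : σ := l.foldl A.update A.init

/-- The number of mistakes made on a sequence of labelled points, starting from state `s`. -/
def mistakesFrom (s : σ) : List (X × Bool) → ℕ
  | [] => 0
  | z :: l => (if A.predict s z.1 = z.2 then 0 else 1) + mistakesFrom (A.update s z) l

/-- The learner does not change its state after a correct classification of the next point. -/
def Conservative : Prop :=
  ∀ (s : σ) (x : X) (y : Bool), A.predict s x = y → A.update s (x, y) = s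

/-- The learner makes at most `k` mistakes on every finite sequence labelled by some `f ∈ F`. -/
def MistakeBound (F : Set (X → Bool)) (k : ℕ) : Prop :=
  ∀ f ∈ F, ∀ xs : List X, A.mistakesFrom A.init (xs.map fun x => (x, f x)) ≤ k

/-- The output class: all classifiers held by the learner after processing some finite
sequence labelled by some `f ∈ F`. -/
def outputClass (F : Set (X → Bool)) : Set (X → Bool) :=
  {h | ∃ f ∈ F, ∃ xs : List X, h = A.predict (A.run (xs.map fun x => (x, f x)))}

/-- Joint measurability of the prediction in the processed sequence and the next point. -/
def IsMeasurable [MeasurableSpace X] : Prop :=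
  ∀ m : ℕ, Measurable fun p : (Fin m → X × Bool) × X => A.predict (A.run (List.ofFn p.1)) p.2

end OnlineLearner

/-! ### The batch classifiers -/

section Batch

variable {X σ : Type*} [LinearOrder X]

/-- The set of the labelled points of a sample. -/
def sampleSet {n : ℕ} (S : Fin n → X × Bool) : Finset (X × Bool) := Finset.univ.image S

/-- A finite set of labelled points, listed in increasing order of the points. The lexicographic
order only serves to break ties between `(x, false)` and `(x, true)`, which cannot both occur
in a realizable sample. -/
def sortedList (T : Finset (X × Bool)) : List (X × Bool) :=
  ((T.map (toLex : X × Bool ≃ X ×ₗ Bool).toEmbedding).sort (· ≤ ·)).map ofLex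

/-- `fhat A S x` is the label of `x` in the sample if `x` is a sample point, and otherwise the
prediction at `x` of the last classifier obtained by running `A` on the labelled sample points
that precede `x`, in increasing order. -/
def fhat (A : OnlineLearner X σ) {n : ℕ} (S : Fin n → X × Bool) (x : X) : Bool :=
  if x ∈ (sampleSet S).image Prod.fst then
    decide ((x, true) ∈ sampleSet S)
  else
    A.predict (A.run (sortedList ((sampleSet S).filter fun z => z.1 ≤ x))) x

/-- Majority vote of three labels. -/
def majority (a b c : Bool) : Bool := (a && b) || (a && c) || (b && c)

/-- The first `m` elements of a sample of size `n`. -/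
def initialPart {n : ℕ} (S : Fin n → X × Bool) (m : ℕ) (h : m ≤ n) : Fin m → X × Bool :=
  fun i => S (Fin.castLE h i)

/-- Majority vote of the three classifiers built from the first third of the sample, the first
two thirds of the sample, and the whole sample. -/
def ghat (A : OnlineLearner X σ) {n : ℕ} (S : Fin n → X × Bool) (x : X) : Bool :=
  majority
    (fhat A (initialPart S (n / 3) (by omega)) x)
    (fhat A (initialPart S (2 * n / 3) (by omega)) x)
    (fhat A S x)

end Batch

/-! ### Sample compression schemes -/

section Compression

variable {X : Type*}

/-- `S` is a sample of the form `(xᵢ, f xᵢ)`. -/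
def LabelledBy (f : X → Bool) {n : ℕ} (S : Fin n → X × Bool) : Prop := ∀ i, (S i).2 = f (S i).1

/-- `(κ, ρ)` is a sample compression scheme of size `k` for the class `F`. -/
structure IsCompressionScheme (F : Set (X → Bool)) (k : ℕ)
    (κ : (n : ℕ) → (Fin n → X × Bool) → Finset (X × Bool))
    (ρ : Finset (X × Bool) → X → Bool) : Prop where
  perm_invariant : ∀ (n : ℕ) (S : Fin n → X × Bool) (π : Equiv.Perm (Fin n)),
    κ n (S ∘ π) = κ n S
  card_le : ∀ (n : ℕ) (S : Fin n → X × Bool), (κ n S).card ≤ k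
  subset_sample : ∀ (n : ℕ), ∀ f ∈ F, ∀ S : Fin n → X × Bool, LabelledBy f S →
    ∀ z ∈ κ n S, ∃ i, S i = z
  consistent : ∀ (n : ℕ), ∀ f ∈ F, ∀ S : Fin n → X × Bool, LabelledBy f S →
    ∀ i, ρ (κ n S) (S i).1 = f (S i).1

/-- A sample compression scheme is stable if deleting a sample element outside the compression
set does not change the compression set. -/
structure IsStableCompressionScheme (F : Set (X → Bool)) (k : ℕ)
    (κ : (n : ℕ) → (Fin n → X × Bool) → Finset (X × Bool))
    (ρ : Finset (X × Bool) → X → Bool) : Prop extends IsCompressionScheme F k κ ρ where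
  stable : ∀ (n : ℕ), ∀ f ∈ F, ∀ S : Fin (n + 1) → X × Bool, LabelledBy f S →
    ∀ i, S i ∉ κ (n + 1) S → κ n (fun j => S (i.succAbove j)) = κ (n + 1) S

end Compression

/-! ### VC dimension and risk -/

/-- `T` is shattered by `H`: every classification of `T` is realized by some `h ∈ H`. -/
def Shatters {X : Type*} (H : Set (X → Bool)) (T : Finset X) : Prop :=
  ∀ g : X → Bool, ∃ h ∈ H, ∀ x ∈ T, h x = g x

/-- The VC dimension, `⊤` if arbitrarily large finite sets are shattered. -/
noncomputable def vcDim {X : Type*} (H : Set (X → Bool)) : ℕ∞ :=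
  ⨆ (T : Finset X) (_ : Shatters H T), (T.card : ℕ∞)

/-- The risk `P(h(X) ≠ Y)`, i.e. the expected binary loss. -/
noncomputable def risk {X : Type*} [MeasurableSpace X] (P : Measure (X × Bool)) (h : X → Bool) :
    ℝ :=
  P.real {z | h z.1 ≠ z.2}

/-- Realizable case: `Y = f(X)` almost surely for some `f ∈ F`. -/
def Realizable {X : Type*} [MeasurableSpace X] (F : Set (X → Bool)) (P : Measure (X × Bool)) :
    Prop :=
  ∃ f ∈ F, ∀ᵐ z ∂P, z.2 = f z.1

end OnlineToBatch

/-!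
The classifier `f̂` is the output of a stable sample compression scheme. The compression set is
the set of points on which the learner errs while it reads the sample in increasing order
(`mistakeSet`); the mistake bound limits its size. As a conservative learner moves only when it
errs, deleting a correctly classified point changes neither the other mistakes
(`mistakeSet_eq_of_subset`) nor the state reached after the points up to any given `x`, so that
`f̂` can be reconstructed from its mistakes (`SetLabelledBy.fhatSet_mistakeSet`).

Stability yields a risk bound of order `(k + log (1 / δ)) / n`
(`measure_risk_gt_le_of_stable`). Split the indices into `2 k` classes of about equal size. The
compression set meets at most `k` of them, and by stability `f̂` is already determined by the
examples in these classes. Once the classes are fixed, `f̂` is therefore independent of at least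
a constant fraction of the sample, on which it makes no error; if its risk exceeds `ε`, this has
probability at most `exp (-ε n / 4)`. The union bound over the choice of classes costs a
factor `4 ^ k`.

For `k = 0` the bound of order `k log (1 / δ) / n` demands risk zero; then the learner never errs
and `f̂` is the target (`risk_fhat_eq_zero`). The majority vote errs only where one of the
classifiers built from two thirds of the sample and from the whole sample errs, so a union bound
for these two gives a bound of order `(k + log (1 / δ)) / n` for its risk as well, which is at
most of the order claimed.

Independence is used through Tonelli's theorem, which requires `f̂` to be jointly measurable in
sample and point (`measurable_fhatSet`): the sorted list of the sample points up to `x` is one of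
countably many subsequences of the sample, and each is the correct one on a measurable event.
-/

namespace OnlineToBatch

/-! ### Compression to the mistakes of a conservative learner -/

namespace OnlineLearner

variable {X σ : Type*} (A : OnlineLearner X σ)

/-- The labelled points of a sequence that are misclassified when the learner processes the
sequence from the state `s`, in the order in which they occur. -/
def mistakeList (s : σ) : List (X × Bool) → List (X × Bool)
  | [] => []
  | z :: l =>
    if A.predict s z.1 = z.2 then mistakeList (A.update s z) l
    else z :: mistakeList (A.update s z) l

theorem mistakeList_sublist (s : σ) (l : List (X × Bool)) : (A.mistakeList s l).Sublist l := by
  induction l generalizing s with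
  | nil => simp [mistakeList]
  | cons z l ih =>
    rw [mistakeList]
    split_ifs
    · exact (ih _).cons _
    · exact (ih _).cons_cons _

theorem length_mistakeList (s : σ) (l : List (X × Bool)) :
    (A.mistakeList s l).length = A.mistakesFrom s l := by
  induction l generalizing s with
  | nil => simp [mistakeList, mistakesFrom]
  | cons z l ih =>
    rw [mistakeList, mistakesFrom]
    split_ifs <;> simp [ih, add_comm]

variable {A}

theorem Conservative.update_eq (hA : A.Conservative) {s : σ} {z : X × Bool}
    (h : A.predict s z.1 = z.2) : A.update s z = s := hA s z.1 z.2 h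

/-- Dropping correctly classified points from a sequence does not affect which points are
misclassified. -/
theorem Conservative.mistakeList_filter (hA : A.Conservative) (p : X × Bool → Bool) (s : σ)
    (l : List (X × Bool)) (h : ∀ z ∈ A.mistakeList s l, p z) :
    A.mistakeList s (l.filter p) = A.mistakeList s l := by
  induction l generalizing s with
  | nil => simp
  | cons z l ih =>
    rw [mistakeList] at h ⊢
    by_cases hz : A.predict s z.1 = z.2
    · rw [if_pos hz] at h ⊢
      rw [hA.update_eq hz] at h ⊢
      by_cases hp : p z
      · rw [List.filter_cons_of_pos hp, mistakeList, if_pos hz, hA.update_eq hz, ih _ h]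
      · rw [List.filter_cons_of_neg hp, ih _ h]
    · rw [if_neg hz] at h ⊢
      rw [List.filter_cons_of_pos (h z (by simp)), mistakeList, if_neg hz,
        ih _ fun w hw => h w (by simp [hw])]

variable [LinearOrder X]

theorem filter_le_eq_nil {l : List (X × Bool)} {x : X} (h : ∀ w ∈ l, x < w.1) :
    (l.filter fun w => w.1 ≤ x) = [] := by
  simpa [List.filter_eq_nil_iff] using h

/-- On a sequence in increasing order, the state reached after the points up to `x` is
determined by the misclassified points up to `x`. -/
theorem Conservative.foldl_filter_mistakeList (hA : A.Conservative) (x : X) (s : σ)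
    (l : List (X × Bool)) (hl : l.Pairwise fun a b => a.1 ≤ b.1) :
    ((A.mistakeList s l).filter fun w => w.1 ≤ x).foldl A.update s
      = (l.filter fun w => w.1 ≤ x).foldl A.update s := by
  induction l generalizing s with
  | nil => simp [mistakeList]
  | cons z l ih =>
    rw [List.pairwise_cons] at hl
    by_cases hx : z.1 ≤ x
    · rw [List.filter_cons_of_pos (by simpa using hx), List.foldl_cons, ← ih _ hl.2, mistakeList]
      split_ifs with hz
      · rw [hA.update_eq hz]
      · rw [List.filter_cons_of_pos (by simpa using hx), List.foldl_cons]
    · have h1 : ∀ w ∈ z :: l, x < w.1 := by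
        intro w hw
        rcases List.mem_cons.1 hw with rfl | hw
        · exact not_le.1 hx
        · exact (not_le.1 hx).trans_le (hl.1 w hw)
      rw [filter_le_eq_nil h1,
        filter_le_eq_nil fun w hw => h1 w ((A.mistakeList_sublist s _).subset hw)]

/-- On a sequence in strictly increasing order, a point that is not misclassified in its turn is
classified correctly by the state reached after the points up to it. -/
theorem Conservative.predict_of_notMem_mistakeList (hA : A.Conservative) {z : X × Bool} (s : σ)
    (l : List (X × Bool)) (hl : l.Pairwise fun a b => a.1 < b.1) (hz : z ∈ l)
    (hm : z ∉ A.mistakeList s l) :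
    A.predict ((l.filter fun w => w.1 ≤ z.1).foldl A.update s) z.1 = z.2 := by
  induction l generalizing s with
  | nil => simp at hz
  | cons w l ih =>
    rw [List.pairwise_cons] at hl
    rw [mistakeList] at hm
    rcases List.mem_cons.1 hz with rfl | hzl
    · have hp : A.predict s z.1 = z.2 := by
        by_contra h
        simp [h] at hm
      rw [List.filter_cons_of_pos (by simp), filter_le_eq_nil hl.1]
      simpa [hA.update_eq hp] using hp
    · rw [List.filter_cons_of_pos (by simpa using (hl.1 z hzl).le), List.foldl_cons]
      refine ih _ hl.2 hzl fun h => hm ?_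
      split_ifs
      · exact h
      · exact List.mem_cons_of_mem _ h

end OnlineLearner

/-- Every label in the set `T` is the value of `f` at its point. -/
def SetLabelledBy {X : Type*} (f : X → Bool) (T : Finset (X × Bool)) : Prop :=
  ∀ z ∈ T, z.2 = f z.1

theorem SetLabelledBy.mono {X : Type*} {f : X → Bool} {T T' : Finset (X × Bool)}
    (hT : SetLabelledBy f T)
    (h : T' ⊆ T) : SetLabelledBy f T' := fun z hz => hT z (h hz)

section Batch

variable {X σ : Type*} [LinearOrder X]

theorem mem_sortedList {T : Finset (X × Bool)} {z : X × Bool} : z ∈ sortedList T ↔ z ∈ T := by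
  simp [sortedList]

theorem pairwise_sortedList (T : Finset (X × Bool)) :
    (sortedList T).Pairwise fun a b => toLex a < toLex b := by
  rw [sortedList, List.pairwise_map]
  exact (Finset.sortedLT_sort _).pairwise

theorem eq_sortedList {T : Finset (X × Bool)} {l : List (X × Bool)}
    (hl : l.Pairwise fun a b => toLex a < toLex b) (h : ∀ z, z ∈ l ↔ z ∈ T) :
    l = sortedList T := by
  have : Std.Irrefl fun a b : X × Bool => toLex a < toLex b := ⟨fun a => lt_irrefl _⟩
  have : Std.Antisymm fun a b : X × Bool => toLex a < toLex b :=
    ⟨fun a b h h' => absurd h' h.asymm⟩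
  refine List.Perm.eq_of_pairwise' hl (pairwise_sortedList T) ?_
  rw [List.perm_ext_iff_of_nodup hl.nodup (pairwise_sortedList T).nodup]
  simpa [mem_sortedList] using h

theorem sortedList_filter (T : Finset (X × Bool)) (p : X × Bool → Prop) [DecidablePred p] :
    sortedList (T.filter p) = (sortedList T).filter p :=
  (eq_sortedList ((pairwise_sortedList T).filter _) (by simp [mem_sortedList])).symm

/-- `f̂` as a function of the set of labelled points of the sample. -/
def fhatSet (A : OnlineLearner X σ) (T : Finset (X × Bool)) (x : X) : Bool :=
  if x ∈ T.image Prod.fst then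
    decide ((x, true) ∈ T)
  else
    A.predict (A.run (sortedList (T.filter fun z => z.1 ≤ x))) x

theorem fhat_eq_fhatSet (A : OnlineLearner X σ) {n : ℕ} (S : Fin n → X × Bool) :
    fhat A S = fhatSet A (sampleSet S) := rfl

/-- The set of labelled points on which the learner errs when it processes a finite set of
labelled points in increasing order. -/
def mistakeSet (A : OnlineLearner X σ) (T : Finset (X × Bool)) : Finset (X × Bool) :=
  (A.mistakeList A.init (sortedList T)).toFinset

theorem LabelledBy.sampleSet {f : X → Bool} {n : ℕ} {S : Fin n → X × Bool}
    (hS : LabelledBy f S) : SetLabelledBy f (sampleSet S) := by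
  intro z hz
  obtain ⟨i, -, rfl⟩ := Finset.mem_image.1 hz
  exact hS i

theorem mistakeSet_subset (A : OnlineLearner X σ) (T : Finset (X × Bool)) :
    mistakeSet A T ⊆ T := by
  intro z hz
  exact mem_sortedList.1 ((A.mistakeList_sublist _ _).subset (List.mem_toFinset.1 hz))

theorem sortedList_mistakeSet (A : OnlineLearner X σ) (T : Finset (X × Bool)) :
    sortedList (mistakeSet A T) = A.mistakeList A.init (sortedList T) :=
  (eq_sortedList ((pairwise_sortedList T).sublist (A.mistakeList_sublist _ _))
    (by simp [mistakeSet])).symm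

theorem card_mistakeSet_le {A : OnlineLearner X σ} {F : Set (X → Bool)} {k : ℕ}
    (hk : A.MistakeBound F k) {f : X → Bool} (hf : f ∈ F) {T : Finset (X × Bool)}
    (hT : SetLabelledBy f T) : (mistakeSet A T).card ≤ k := by
  refine (List.toFinset_card_le _).trans ?_
  rw [A.length_mistakeList]
  have hmap : ((sortedList T).map Prod.fst).map (fun x => (x, f x)) = sortedList T := by
    rw [List.map_map]
    refine (List.map_congr_left (g := id) fun z hz => ?_).trans (List.map_id _)
    exact Prod.ext rfl (hT z (mem_sortedList.1 hz)).symm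
  have := hk f hf ((sortedList T).map Prod.fst)
  rwa [hmap] at this

/-- Stability: the misclassified points do not change when correctly classified points are
removed. -/
theorem mistakeSet_eq_of_subset {A : OnlineLearner X σ} (hA : A.Conservative)
    {T T' : Finset (X × Bool)} (h : mistakeSet A T ⊆ T') (h' : T' ⊆ T) :
    mistakeSet A T' = mistakeSet A T := by
  have hT' : T' = T.filter (· ∈ T') := by
    ext z
    simpa using @h' z
  conv_lhs => rw [hT']
  rw [mistakeSet, sortedList_filter, hA.mistakeList_filter]
  · rfl
  · intro z hz
    simpa using h (List.mem_toFinset.2 hz)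

theorem SetLabelledBy.pairwise_sortedList {f : X → Bool} {T : Finset (X × Bool)}
    (hT : SetLabelledBy f T) : (sortedList T).Pairwise fun a b => a.1 < b.1 := by
  refine (OnlineToBatch.pairwise_sortedList T).imp_of_mem fun {a b} ha hb hab => ?_
  rcases Prod.Lex.toLex_lt_toLex.1 hab with h | ⟨h, h2⟩
  · exact h
  · rw [hT a (mem_sortedList.1 ha), hT b (mem_sortedList.1 hb), h] at h2
    exact absurd h2 (lt_irrefl _)

theorem SetLabelledBy.fhatSet_eq {f : X → Bool} {T : Finset (X × Bool)}
    (hT : SetLabelledBy f T) (A : OnlineLearner X σ) {z : X × Bool} (hz : z ∈ T) :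
    fhatSet A T z.1 = f z.1 := by
  rw [fhatSet, if_pos (Finset.mem_image_of_mem _ hz)]
  have hz' := hT z hz
  by_cases h : (z.1, true) ∈ T
  · simpa [h] using hT _ h
  · cases hb : f z.1
    · simp [h]
    · exact absurd (by rwa [← hb, ← hz']) h

/-- `f̂` is determined by the misclassified points of the sample. -/
theorem SetLabelledBy.fhatSet_mistakeSet {f : X → Bool} {T : Finset (X × Bool)}
    (hT : SetLabelledBy f T) {A : OnlineLearner X σ} (hA : A.Conservative) :
    fhatSet A (mistakeSet A T) = fhatSet A T := by
  have hM := hT.mono (mistakeSet_subset A T)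
  have hrun (x : X) : A.run (sortedList ((mistakeSet A T).filter fun z => z.1 ≤ x))
      = A.run (sortedList (T.filter fun z => z.1 ≤ x)) := by
    rw [sortedList_filter, sortedList_filter, sortedList_mistakeSet]
    exact hA.foldl_filter_mistakeList x A.init _ (hT.pairwise_sortedList.imp le_of_lt)
  funext x
  by_cases hx : x ∈ T.image Prod.fst
  · obtain ⟨z, hz, rfl⟩ := Finset.mem_image.1 hx
    rw [hT.fhatSet_eq A hz]
    by_cases hzM : z.1 ∈ (mistakeSet A T).image Prod.fst
    · obtain ⟨w, hw, hwz⟩ := Finset.mem_image.1 hzM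
      rw [← hwz, hM.fhatSet_eq A hw]
    · rw [fhatSet, if_neg hzM, hrun, sortedList_filter, ← hT z hz]
      refine hA.predict_of_notMem_mistakeList A.init _ hT.pairwise_sortedList
        (mem_sortedList.2 hz) fun h => hzM ?_
      exact Finset.mem_image_of_mem _ (List.mem_toFinset.2 h)
  · have hxM : x ∉ (mistakeSet A T).image Prod.fst := fun h =>
      hx (Finset.image_subset_image (mistakeSet_subset A T) h)
    rw [fhatSet, fhatSet, if_neg hx, if_neg hxM, hrun]

theorem exists_isStableCompressionScheme {F : Set (X → Bool)} {k : ℕ} {A : OnlineLearner X σ}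
    (hA : A.Conservative) (hk : A.MistakeBound F k) :
    ∃ (κ : (n : ℕ) → (Fin n → X × Bool) → Finset (X × Bool))
      (ρ : Finset (X × Bool) → X → Bool), IsStableCompressionScheme F k κ ρ ∧
      ∀ (n : ℕ), ∀ f ∈ F, ∀ S : Fin n → X × Bool, LabelledBy f S → fhat A S = ρ (κ n S) := by
  -- The size bound is also demanded of samples that no `f ∈ F` labels; on these the learner may
  -- err more than `k` times, and the compression set is taken to be empty.
  let κ : (n : ℕ) → (Fin n → X × Bool) → Finset (X × Bool) := fun n S =>
    if (mistakeSet A (sampleSet S)).card ≤ k then mistakeSet A (sampleSet S) else ∅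
  have hκ : ∀ n, ∀ f ∈ F, ∀ S : Fin n → X × Bool, LabelledBy f S →
      κ n S = mistakeSet A (sampleSet S) := fun n f hf S hS =>
    if_pos (card_mistakeSet_le hk hf hS.sampleSet)
  refine ⟨κ, fhatSet A, ⟨⟨?_, ?_, ?_, ?_⟩, ?_⟩, ?_⟩
  · intro n S π
    have : sampleSet (S ∘ π) = sampleSet S := by
      ext z
      simp only [sampleSet, Finset.mem_image, Finset.mem_univ, true_and, Function.comp]
      exact π.surjective.exists (p := fun i => S i = z) |>.symm
    simp only [κ, this]
  · intro n S
    simp only [κ]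
    split_ifs with h
    · exact h
    · simp
  · intro n f hf S hS z hz
    rw [hκ n f hf S hS] at hz
    simpa [sampleSet] using mistakeSet_subset A _ hz
  · intro n f hf S hS i
    rw [hκ n f hf S hS, hS.sampleSet.fhatSet_mistakeSet hA]
    exact hS.sampleSet.fhatSet_eq A (Finset.mem_image_of_mem _ (Finset.mem_univ i))
  · intro n f hf S hS i hi
    rw [hκ _ f hf S hS] at hi ⊢
    rw [hκ n f hf (fun j => S (i.succAbove j)) fun j => hS _]
    refine mistakeSet_eq_of_subset hA (fun z hz => ?_) fun z hz => ?_
    · obtain ⟨j, -, rfl⟩ := Finset.mem_image.1 (mistakeSet_subset A _ hz)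
      have hj : j ≠ i := by
        rintro rfl
        exact hi hz
      obtain ⟨j', rfl⟩ := Fin.exists_succAbove_eq hj
      exact Finset.mem_image_of_mem (fun j => S (i.succAbove j)) (Finset.mem_univ j')
    · obtain ⟨j, -, rfl⟩ := Finset.mem_image.1 hz
      exact Finset.mem_image_of_mem _ (Finset.mem_univ _)
  · intro n f hf S hS
    rw [hκ n f hf S hS, hS.sampleSet.fhatSet_mistakeSet hA, fhat_eq_fhatSet]

end Batch

/-! ### Risk of stable compression schemes -/

section Tail

variable {X : Type*} [MeasurableSpace X] {P : Measure (X × Bool)}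

theorem risk_le_one [IsProbabilityMeasure P] (h : X → Bool) : risk P h ≤ 1 := measureReal_le_one

/-- Draw two independent samples and train on the first one. The probability that the resulting
classifier is consistent with the second sample and nevertheless has risk above `ε` is
exponentially small in the size of the second sample. -/
theorem measure_prod_consistent_le [IsProbabilityMeasure P] {ι ι' : Type*} [Fintype ι]
    [Fintype ι'] {h : (ι → X × Bool) → X → Bool}
    (hh : Measurable fun p : (ι → X × Bool) × X => h p.1 p.2) (ε : ℝ) :
    ((Measure.pi fun _ : ι => P).prod (Measure.pi fun _ : ι' => P))
      {p | ε < risk P (h p.1) ∧ ∀ j, h p.1 (p.2 j).1 = (p.2 j).2}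
      ≤ ENNReal.ofReal (Real.exp (-(ε * Fintype.card ι'))) := by
  have hgood : MeasurableSet {q : (ι → X × Bool) × (X × Bool) | h q.1 q.2.1 = q.2.2} :=
    measurableSet_eq_fun (hh.comp (by fun_prop : Measurable fun q : (ι → X × Bool) × (X × Bool) =>
      (q.1, q.2.1))) (by fun_prop)
  have hrisk : Measurable fun T => risk P (h T) :=
    (measurable_measure_prodMk_left hgood.compl).ennreal_toReal
  have hE : MeasurableSet {p : (ι → X × Bool) × (ι' → X × Bool) |
      ε < risk P (h p.1) ∧ ∀ j, h p.1 (p.2 j).1 = (p.2 j).2} := by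
    refine (measurableSet_lt measurable_const (hrisk.comp measurable_fst)).inter ?_
    refine measurableSet_setOfPred.2 (Measurable.forall fun j => measurableSet_setOfPred.1 ?_)
    exact hgood.preimage
      (by fun_prop : Measurable fun p : (ι → X × Bool) × (ι' → X × Bool) => (p.1, p.2 j))
  rw [Measure.prod_apply hE]
  refine (lintegral_mono (g := fun _ => ENNReal.ofReal (Real.exp (-(ε * Fintype.card ι'))))
    fun T => ?_).trans (by simp)
  by_cases hT : ε < risk P (h T)
  · have hset : Prod.mk T ⁻¹' {p : (ι → X × Bool) × (ι' → X × Bool) |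
        ε < risk P (h p.1) ∧ ∀ j, h p.1 (p.2 j).1 = (p.2 j).2}
        = Set.univ.pi fun _ : ι' => {z : X × Bool | h T z.1 = z.2} := by
      ext S
      simp [hT]
    have hgT : MeasurableSet {z : X × Bool | h T z.1 = z.2} :=
      hgood.preimage (measurable_prodMk_left (x := T))
    have hP : P {z : X × Bool | h T z.1 = z.2} ≤ ENNReal.ofReal (Real.exp (-ε)) := by
      have hc : {z : X × Bool | h T z.1 = z.2}ᶜ = {z | h T z.1 ≠ z.2} := rfl
      have := probReal_add_probReal_compl (μ := P) hgT
      rw [hc] at this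
      change _ + risk P (h T) = 1 at this
      rw [← ofReal_measureReal]
      refine ENNReal.ofReal_le_ofReal ?_
      linarith [Real.add_one_le_exp (-ε)]
    calc (Measure.pi fun _ : ι' => P) _
        = P {z : X × Bool | h T z.1 = z.2} ^ Fintype.card ι' := by
          rw [hset, Measure.pi_pi, Finset.prod_const, Finset.card_univ]
      _ ≤ ENNReal.ofReal (Real.exp (-ε)) ^ Fintype.card ι' := by gcongr
      _ = ENNReal.ofReal (Real.exp (-(ε * Fintype.card ι'))) := by
          rw [← ENNReal.ofReal_pow (Real.exp_pos _).le, ← Real.exp_nat_mul]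
          congr 2
          ring
  · have hset : Prod.mk T ⁻¹' {p : (ι → X × Bool) × (ι' → X × Bool) |
        ε < risk P (h p.1) ∧ ∀ j, h p.1 (p.2 j).1 = (p.2 j).2} = ∅ := by
      ext S
      simp [hT]
    simp only [hset, measure_empty, zero_le]

/-- The variant of `measure_prod_consistent_le` for one sample, with training on the examples
whose indices lie in `J`. -/
theorem measure_pi_consistent_le [IsProbabilityMeasure P] [DecidableEq X] {n : ℕ}
    {ρ : Finset (X × Bool) → X → Bool} (J : Finset (Fin n))
    (hρ : Measurable fun p : (J → X × Bool) × X => ρ (Finset.univ.image p.1) p.2) (ε : ℝ) :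
    (Measure.pi fun _ : Fin n => P)
      {S | ε < risk P (ρ (J.image S)) ∧ ∀ i ∉ J, ρ (J.image S) (S i).1 = (S i).2}
      ≤ ENNReal.ofReal (Real.exp (-(ε * (Jᶜ).card))) := by
  have h1 := measurePreserving_piEquivPiSubtypeProd (fun _ : Fin n => P) (· ∈ J)
  have h2 := measure_prod_consistent_le (P := P) (ι' := {i // i ∉ J})
    (h := fun T : J → X × Bool => ρ (Finset.univ.image T)) hρ ε
  rw [Subsingleton.elim (Subtype.fintype (· ∈ J)) (Finset.Subtype.fintype J)] at h1
  have hc : Fintype.card {i // i ∉ J} = (Jᶜ).card := by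
    rw [Fintype.card_subtype_compl, Finset.card_compl, Fintype.card_coe]
  rw [hc] at h2
  refine le_trans ?_ ((h1.measure_preimage_le _).trans h2)
  refine measure_mono fun S hS => ?_
  have himg : Finset.univ.image (fun i : J => S i) = J.image S := by
    ext z
    simp
  change ε < risk P (ρ (Finset.univ.image fun i : J => S i)) ∧
    ∀ j : {i // i ∉ J}, ρ (Finset.univ.image fun i : J => S i) (S j).1 = (S j).2
  rw [himg]
  exact ⟨hS.1, fun j => hS.2 j j.2⟩

/-- Splitting `Fin n` into residue classes modulo `K`, the classes in `I` together contain
at least `|I| * ⌊n / K⌋` indices. -/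
theorem card_mul_div_le_card_residues {n K : ℕ} (I : Finset (Fin K)) :
    I.card * (n / K) ≤ (Finset.univ.filter fun i : Fin n => ∃ r ∈ I, (r : ℕ) = i % K).card := by
  have hlt (q : I × Fin (n / K)) : (q.1 : ℕ) + K * q.2 < n := by
    have h1 := q.1.1.2
    have h2 := q.2.2
    have h3 : K * ((q.2 : ℕ) + 1) ≤ K * (n / K) := Nat.mul_le_mul_left _ h2
    have h4 := Nat.mul_div_le n K
    rw [mul_add] at h3
    omega
  have hmod (q : I × Fin (n / K)) : ((q.1 : ℕ) + K * q.2) % K = q.1 := by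
    rw [Nat.add_mul_mod_self_left, Nat.mod_eq_of_lt q.1.1.2]
  have hinj : Function.Injective fun q : I × Fin (n / K) =>
      (⟨(q.1 : ℕ) + K * q.2, hlt q⟩ : Fin n) := by
    intro q q' h
    have h0 : (q.1 : ℕ) + K * q.2 = q'.1 + K * q'.2 := congrArg Fin.val h
    have h1 : (q.1 : ℕ) = q'.1 := by rw [← hmod q, h0, hmod q']
    have hK : 0 < K := q.1.1.pos
    have h2 : (q.2 : ℕ) = q'.2 := by
      rw [h1] at h0
      exact Nat.eq_of_mul_eq_mul_left hK (Nat.add_left_cancel h0)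
    exact Prod.ext (Subtype.ext (Fin.ext h1)) (Fin.ext h2)
  have hc : Fintype.card (I × Fin (n / K)) = I.card * (n / K) := by simp
  rw [← hc, ← Finset.card_univ, ← Finset.card_image_of_injective _ hinj]
  refine Finset.card_le_card fun i hi => ?_
  obtain ⟨q, -, rfl⟩ := Finset.mem_image.1 hi
  exact Finset.mem_filter.2 ⟨Finset.mem_univ _, q.1, q.1.2, (hmod q).symm⟩

/-- Risk bound for consistent, stable sample compression: if `ρ` of a labelled set is determined
by a subset of at most `k` points and does not change when other points are deleted, then
with probability at least `1 - δ` its risk is at most `4 (k log 4 + log (1 / δ)) / n`.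

The indices are split into `2 k` classes, of which the compression set meets at most `k`.
By stability `ρ` of the sample equals `ρ` of the part of the sample in those classes, and this
classifier is independent of the other half of the sample, with which it is consistent. A union
bound over the `4 ^ k` sets of classes gives the result. -/
theorem measure_risk_gt_le_of_stable [IsProbabilityMeasure P] [DecidableEq X] {f : X → Bool}
    (hf : ∀ᵐ z ∂P, z.2 = f z.1) {ρ : Finset (X × Bool) → X → Bool} {k : ℕ} (hk : 1 ≤ k)
    (hρ : ∀ (ι : Type) [Fintype ι],
      Measurable fun p : (ι → X × Bool) × X => ρ (Finset.univ.image p.1) p.2)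
    (hstab : ∀ T, SetLabelledBy f T → ∃ M ⊆ T, M.card ≤ k ∧
      ∀ T', M ⊆ T' → T' ⊆ T → ρ T' = ρ T)
    (hcons : ∀ T, SetLabelledBy f T → ∀ z ∈ T, ρ T z.1 = f z.1)
    {n : ℕ} (hn : 1 ≤ n) {δ ε : ℝ} (hδ : 0 < δ) (hδ1 : δ ≤ 1)
    (hε : 4 * (k * Real.log 4 + Real.log (1 / δ)) ≤ ε * n) :
    (Measure.pi fun _ : Fin n => P) {S | ε < risk P (ρ (Finset.univ.image S))}
      ≤ ENNReal.ofReal δ := by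
  have hlog4 : (1 : ℝ) ≤ Real.log 4 := by
    rw [Real.le_log_iff_exp_le (by norm_num)]
    linarith [Real.exp_one_lt_d9]
  have hlogδ : 0 ≤ Real.log (1 / δ) := Real.log_nonneg (by rw [le_div_iff₀ hδ]; linarith)
  have hkR : (1 : ℝ) ≤ k := by exact_mod_cast hk
  have hnR : (1 : ℝ) ≤ n := by exact_mod_cast hn
  have hε0 : 0 ≤ ε := by
    by_contra h
    nlinarith
  rcases lt_or_ge n (2 * k) with hnk | hnk
  · -- With fewer than `2 k` examples the bound exceeds `1`.
    have hnkR : (n : ℝ) < 2 * k := by exact_mod_cast hnk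
    have h1 : 1 ≤ ε := by
      by_contra h
      nlinarith
    have hempty : {S : Fin n → X × Bool | ε < risk P (ρ (Finset.univ.image S))} = ∅ := by
      ext S
      simpa using (risk_le_one _).trans h1
    simp [hempty]
  -- `J I` is the set of indices in the classes of `I`.
  let J : Finset (Fin (2 * k)) → Finset (Fin n) := fun I =>
    Finset.univ.filter fun i : Fin n => ∃ r ∈ I, (r : ℕ) = i % (2 * k)
  let 𝓘 : Finset (Finset (Fin (2 * k))) := Finset.univ.filter fun I => I.card ≤ k
  have hJ (I) (hI : I ∈ 𝓘) : (n : ℝ) ≤ 4 * ((J I)ᶜ).card := by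
    have h1 := card_mul_div_le_card_residues (n := n) Iᶜ
    have h2 : k ≤ Iᶜ.card := by
      have := (Finset.mem_filter.1 hI).2
      rw [Finset.card_compl, Fintype.card_fin]
      omega
    have h3 : (Finset.univ.filter fun i : Fin n => ∃ r ∈ Iᶜ, (r : ℕ) = i % (2 * k)) ⊆ (J I)ᶜ := by
      intro i hi
      obtain ⟨r, hr, hri⟩ := (Finset.mem_filter.1 hi).2
      rw [Finset.mem_compl, Finset.mem_filter]
      rintro ⟨-, r', hr', hri'⟩
      exact Finset.mem_compl.1 hr (by rwa [Fin.ext (hri.trans hri'.symm)])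
    have h4 : k * (n / (2 * k)) ≤ ((J I)ᶜ).card :=
      (Nat.mul_le_mul_right _ h2).trans (h1.trans (Finset.card_le_card h3))
    have h5 : n < 2 * k * (n / (2 * k) + 1) := Nat.lt_mul_div_succ n (by omega)
    have h6 : 1 ≤ n / (2 * k) := (Nat.one_le_div_iff (by omega)).2 hnk
    have h7 : n ≤ 4 * ((J I)ᶜ).card := by nlinarith
    exact_mod_cast h7
  have hae : ∀ᵐ S ∂(Measure.pi fun _ : Fin n => P), ∀ i, (S i).2 = f (S i).1 :=
    ae_all_iff.2 fun i => (Measure.quasiMeasurePreserving_eval (fun _ : Fin n => P) i).ae hf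
  have hsub : ∀ᵐ S ∂(Measure.pi fun _ : Fin n => P),
      S ∈ {S : Fin n → X × Bool | ε < risk P (ρ (Finset.univ.image S))} →
      S ∈ ⋃ I ∈ 𝓘, {S | ε < risk P (ρ ((J I).image S)) ∧
        ∀ i ∉ J I, ρ ((J I).image S) (S i).1 = (S i).2} := by
    filter_upwards [hae] with S hS hbad
    have hlab : SetLabelledBy f (Finset.univ.image S) := by
      intro z hz
      obtain ⟨i, -, rfl⟩ := Finset.mem_image.1 hz
      exact hS i
    obtain ⟨M, hM, hMk, hMρ⟩ := hstab _ hlab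
    have hpick : ∀ z : X × Bool, ∃ i : Fin n, z ∈ M → S i = z := by
      intro z
      by_cases hz : z ∈ M
      · obtain ⟨i, -, hi⟩ := Finset.mem_image.1 (hM hz)
        exact ⟨i, fun _ => hi⟩
      · exact ⟨⟨0, hn⟩, fun h => absurd h hz⟩
    choose pick hpick using hpick
    let I : Finset (Fin (2 * k)) := M.image fun z => ⟨pick z % (2 * k), Nat.mod_lt _ (by omega)⟩
    have hI : I ∈ 𝓘 :=
      Finset.mem_filter.2 ⟨Finset.mem_univ _, Finset.card_image_le.trans hMk⟩
    have heq : ρ ((J I).image S) = ρ (Finset.univ.image S) := by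
      refine hMρ _ (fun z hz => ?_) (Finset.image_subset_image (Finset.subset_univ _))
      refine Finset.mem_image.2 ⟨pick z, ?_, hpick z hz⟩
      exact Finset.mem_filter.2 ⟨Finset.mem_univ _, _, Finset.mem_image_of_mem _ hz, rfl⟩
    refine Set.mem_biUnion hI ⟨by rw [heq]; exact hbad, fun i _ => ?_⟩
    rw [heq, hS i]
    exact hcons _ hlab _ (Finset.mem_image_of_mem _ (Finset.mem_univ i))
  have hcard : (𝓘.card : ℝ) ≤ 4 ^ k := by
    have : 𝓘.card ≤ 4 ^ k := by
      refine (Finset.card_le_univ _).trans ?_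
      rw [Fintype.card_finset, Fintype.card_fin, pow_mul]
      norm_num
    exact_mod_cast this
  calc (Measure.pi fun _ : Fin n => P) {S | ε < risk P (ρ (Finset.univ.image S))}
      ≤ (Measure.pi fun _ : Fin n => P) (⋃ I ∈ 𝓘, {S | ε < risk P (ρ ((J I).image S)) ∧
        ∀ i ∉ J I, ρ ((J I).image S) (S i).1 = (S i).2}) := measure_mono_ae hsub
    _ ≤ ∑ I ∈ 𝓘, (Measure.pi fun _ : Fin n => P) {S | ε < risk P (ρ ((J I).image S)) ∧
        ∀ i ∉ J I, ρ ((J I).image S) (S i).1 = (S i).2} := measure_biUnion_finset_le _ _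
    _ ≤ ∑ _I ∈ 𝓘, ENNReal.ofReal (Real.exp (-(ε * n / 4))) := by
        refine Finset.sum_le_sum fun I hI => ?_
        refine (measure_pi_consistent_le (P := P) (J I) (hρ _) ε).trans ?_
        refine ENNReal.ofReal_le_ofReal (Real.exp_le_exp.2 ?_)
        nlinarith [hJ I hI]
    _ = ENNReal.ofReal (𝓘.card * Real.exp (-(ε * n / 4))) := by
        rw [Finset.sum_const, nsmul_eq_mul, ENNReal.ofReal_mul (by positivity),
          ENNReal.ofReal_natCast]
    _ ≤ ENNReal.ofReal δ := by
        refine ENNReal.ofReal_le_ofReal ?_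
        have h4 : (4 : ℝ) ^ k = Real.exp (k * Real.log 4) := by
          rw [Real.exp_nat_mul, Real.exp_log (by norm_num)]
        have hδe : δ = Real.exp (-Real.log (1 / δ)) := by
          rw [one_div, Real.log_inv, neg_neg, Real.exp_log hδ]
        calc (𝓘.card : ℝ) * Real.exp (-(ε * n / 4))
            ≤ 4 ^ k * Real.exp (-(ε * n / 4)) := by gcongr
          _ = Real.exp (k * Real.log 4 + -(ε * n / 4)) := by rw [h4, ← Real.exp_add]
          _ ≤ Real.exp (-Real.log (1 / δ)) := Real.exp_le_exp.2 (by linarith)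
          _ = δ := hδe.symm

/-- A subfamily of an i.i.d. sample is an i.i.d. sample from the same distribution. -/
theorem measurePreserving_comp_injective [IsProbabilityMeasure P] {m n : ℕ} {e : Fin m → Fin n}
    (he : Function.Injective e) :
    MeasurePreserving (fun S : Fin n → X × Bool => fun i => S (e i))
      (Measure.pi fun _ => P) (Measure.pi fun _ => P) := by
  have hm : Measurable fun S : Fin n → X × Bool => fun i => S (e i) := by fun_prop
  refine ⟨hm, (Measure.pi_eq fun s hs => ?_).symm⟩
  rw [Measure.map_apply hm (MeasurableSet.univ_pi hs)]
  have hpre : (fun S : Fin n → X × Bool => fun i => S (e i)) ⁻¹' Set.univ.pi s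
      = Set.univ.pi (Function.extend e s fun _ => Set.univ) := by
    ext S
    simp only [Set.mem_preimage, Set.mem_pi, Set.mem_univ, true_implies]
    refine ⟨fun h i => ?_, fun h i => by simpa [he.extend_apply] using h (e i)⟩
    by_cases hi : ∃ j, e j = i
    · obtain ⟨j, rfl⟩ := hi
      simpa [he.extend_apply] using h j
    · simp [Function.extend_apply' _ _ _ hi]
  rw [hpre, Measure.pi_pi]
  symm
  refine Fintype.prod_of_injective e he _ _ (fun i hi => ?_) fun j => by rw [he.extend_apply]
  rw [Function.extend_apply' _ _ _ hi, measure_univ]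

end Tail

/-! ### Joint measurability of the batch classifier -/

section Measurability

variable {X σ : Type*} [LinearOrder X]

/-- The sequence of sample points selected by `e` is the sorted list of the distinct sample
points up to `x`. -/
def SortsUpTo {ι : Type*} (S : ι → X × Bool) (x : X) {m : ℕ} (e : Fin m → ι) : Prop :=
  (∀ a b, a < b → toLex (S (e a)) < toLex (S (e b))) ∧ (∀ a, (S (e a)).1 ≤ x) ∧
    ∀ i, ¬ (S i).1 ≤ x ∨ ∃ a, S (e a) = S i

theorem SortsUpTo.ofFn_eq {ι : Type*} [Fintype ι] {S : ι → X × Bool} {x : X} {m : ℕ}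
    {e : Fin m → ι} (h : SortsUpTo S x e) :
    List.ofFn (fun a => S (e a))
      = sortedList ((Finset.univ.image S).filter fun z => z.1 ≤ x) := by
  refine eq_sortedList (List.pairwise_ofFn.2 fun a b hab => h.1 a b hab) fun z => ?_
  simp only [List.mem_ofFn, Finset.mem_filter, Finset.mem_image, Finset.mem_univ,
    true_and]
  constructor
  · rintro ⟨a, rfl⟩
    exact ⟨⟨_, rfl⟩, h.2.1 a⟩
  · rintro ⟨⟨i, rfl⟩, hi⟩
    exact (h.2.2 i).resolve_left (not_not.2 hi)

theorem exists_sortsUpTo {ι : Type*} [Fintype ι] (S : ι → X × Bool) (x : X) :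
    ∃ (m : ℕ) (e : Fin m → ι), SortsUpTo S x e := by
  set l := sortedList ((Finset.univ.image S).filter fun z => z.1 ≤ x) with hl
  have hmem {z} : z ∈ l ↔ (∃ i, S i = z) ∧ z.1 ≤ x := by simp [hl, mem_sortedList]
  have hex (a : Fin l.length) : ∃ i, S i = l.get a := (hmem.1 (l.get_mem a)).1
  choose e he using hex
  refine ⟨l.length, e, fun a b hab => ?_, fun a => ?_, fun i => ?_⟩
  · rw [he, he]
    exact List.pairwise_iff_get.1 (pairwise_sortedList _) a b hab
  · rw [he]
    exact (hmem.1 (l.get_mem a)).2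
  · by_cases hi : (S i).1 ≤ x
    · obtain ⟨a, ha⟩ := List.get_of_mem (hmem.2 ⟨⟨i, rfl⟩, hi⟩)
      exact Or.inr ⟨a, (he a).trans ha⟩
    · exact Or.inl hi

variable [MeasurableSpace X]

theorem measurableSet_le_of_graph (hle : MeasurableSet {p : X × X | p.1 ≤ p.2}) {α : Type*}
    [MeasurableSpace α] {a b : α → X} (ha : Measurable a) (hb : Measurable b) :
    MeasurableSet {p | a p ≤ b p} := hle.preimage (ha.prodMk hb)

theorem measurableSet_lt_of_graph (hle : MeasurableSet {p : X × X | p.1 ≤ p.2}) {α : Type*}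
    [MeasurableSpace α] {a b : α → X} (ha : Measurable a) (hb : Measurable b) :
    MeasurableSet {p | a p < b p} := by
  simpa only [Set.compl_ofPred, not_le] using (measurableSet_le_of_graph hle hb ha).compl

theorem measurableSet_eq_of_graph (hle : MeasurableSet {p : X × X | p.1 ≤ p.2}) {α : Type*}
    [MeasurableSpace α] {a b : α → X} (ha : Measurable a) (hb : Measurable b) :
    MeasurableSet {p | a p = b p} := by
  simp only [le_antisymm_iff]
  exact (measurableSet_le_of_graph hle ha hb).inter (measurableSet_le_of_graph hle hb ha)

theorem measurableSet_pair_eq_of_graph (hle : MeasurableSet {p : X × X | p.1 ≤ p.2}) {α : Type*}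
    [MeasurableSpace α] {a b : α → X × Bool} (ha : Measurable a) (hb : Measurable b) :
    MeasurableSet {p | a p = b p} := by
  simp only [Prod.ext_iff]
  exact (measurableSet_eq_of_graph hle ha.fst hb.fst).inter
    (measurableSet_eq_fun ha.snd hb.snd)

theorem measurableSet_lex_lt_of_graph (hle : MeasurableSet {p : X × X | p.1 ≤ p.2}) {α : Type*}
    [MeasurableSpace α] {a b : α → X × Bool} (ha : Measurable a) (hb : Measurable b) :
    MeasurableSet {p | toLex (a p) < toLex (b p)} := by
  simp only [Prod.Lex.toLex_lt_toLex]
  exact (measurableSet_lt_of_graph hle ha.fst hb.fst).union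
    ((measurableSet_eq_of_graph hle ha.fst hb.fst).inter
      ((MeasurableSet.of_discrete (s := {q : Bool × Bool | q.1 < q.2})).preimage
        (ha.snd.prodMk hb.snd)))

theorem measurableSet_sortsUpTo (hle : MeasurableSet {p : X × X | p.1 ≤ p.2}) {ι : Type*}
    [Finite ι] {m : ℕ} (e : Fin m → ι) :
    MeasurableSet {p : (ι → X × Bool) × X | SortsUpTo p.1 p.2 e} := by
  have hS (i : ι) : Measurable fun p : (ι → X × Bool) × X => p.1 i := by fun_prop
  refine MeasurableSet.inter ?_ (MeasurableSet.inter ?_ ?_)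
  · refine measurableSet_setOfPred.2 (Measurable.forall fun a => Measurable.forall fun b => ?_)
    exact Measurable.imp measurable_const
      (measurableSet_setOfPred.1 (measurableSet_lex_lt_of_graph hle (hS _) (hS _)))
  · refine measurableSet_setOfPred.2 (Measurable.forall fun a => ?_)
    exact measurableSet_setOfPred.1 (measurableSet_le_of_graph hle (hS _).fst measurable_snd)
  · refine measurableSet_setOfPred.2 (Measurable.forall fun i => Measurable.or ?_ ?_)
    · exact (measurableSet_setOfPred.1 (measurableSet_le_of_graph hle (hS i).fst measurable_snd)).not
    · exact Measurable.exists fun a =>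
        measurableSet_setOfPred.1 (measurableSet_pair_eq_of_graph hle (hS _) (hS _))

/-- The prediction of `f̂` is jointly measurable in the sample and the point. -/
theorem measurable_fhatSet (hle : MeasurableSet {p : X × X | p.1 ≤ p.2})
    {A : OnlineLearner X σ} (hA : A.IsMeasurable) (ι : Type*) [Fintype ι] :
    Measurable fun p : (ι → X × Bool) × X => fhatSet A (Finset.univ.image p.1) p.2 := by
  have hS (i : ι) : Measurable fun p : (ι → X × Bool) × X => p.1 i := by fun_prop
  have hhit : MeasurableSet {p : (ι → X × Bool) × X |
      p.2 ∈ (Finset.univ.image p.1).image Prod.fst} := by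
    simp only [Finset.mem_image, Finset.mem_univ, true_and, exists_exists_eq_and]
    exact measurableSet_setOfPred.2 (Measurable.exists fun i =>
      measurableSet_setOfPred.1 (measurableSet_eq_of_graph hle (hS i).fst measurable_snd))
  have htrue : MeasurableSet {p : (ι → X × Bool) × X |
      (p.2, true) ∈ Finset.univ.image p.1} := by
    simp only [Finset.mem_image, Finset.mem_univ, true_and]
    exact measurableSet_setOfPred.2 (Measurable.exists fun i =>
      measurableSet_setOfPred.1 (measurableSet_pair_eq_of_graph hle (hS i)
        (measurable_snd.prodMk measurable_const)))
  refine Measurable.ite hhit (measurable_to_bool (by simpa [Set.preimage] using htrue))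
    (measurable_to_bool ?_)
  -- There are countably many ways to select a sequence of sample points; on the event that a
  -- given selection lists the sample points up to `x`, measurability of `A` applies.
  have hset : (fun p : (ι → X × Bool) × X => A.predict (A.run (sortedList
        ((Finset.univ.image p.1).filter fun z => z.1 ≤ p.2))) p.2) ⁻¹' {true}
      = ⋃ (m : ℕ) (e : Fin m → ι), {p : (ι → X × Bool) × X | SortsUpTo p.1 p.2 e} ∩
        {p | A.predict (A.run (List.ofFn fun a => p.1 (e a))) p.2 = true} := by
    ext p
    simp only [Set.mem_preimage, Set.mem_singleton_iff, Set.mem_iUnion, Set.mem_inter_iff,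
      Set.mem_ofPred_eq]
    constructor
    · intro h
      obtain ⟨m, e, he⟩ := exists_sortsUpTo p.1 p.2
      exact ⟨m, e, he, by rwa [he.ofFn_eq]⟩
    · rintro ⟨m, e, he, h⟩
      rwa [he.ofFn_eq] at h
  rw [hset]
  refine MeasurableSet.iUnion fun m => MeasurableSet.iUnion fun e =>
    (measurableSet_sortsUpTo hle e).inter ?_
  have := (hA m).comp (by fun_prop : Measurable fun p : (ι → X × Bool) × X =>
    ((fun a => p.1 (e a) : Fin m → X × Bool), p.2))
  exact this (measurableSet_singleton true)

end Measurability

/-! ### Rates for the batch classifier and the majority vote -/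

section Rates

theorem one_le_tlog (x : ℝ) : 1 ≤ tlog x := by
  rw [tlog, Real.le_log_iff_exp_le (by positivity)]
  exact le_max_right _ _

theorem log_le_tlog {x : ℝ} (hx : 0 < x) : Real.log x ≤ tlog x :=
  Real.log_le_log hx (le_max_left _ _)

theorem log_four_le_two : Real.log 4 ≤ 2 := by
  have h : Real.log 4 = 2 * Real.log 2 := by
    rw [show (4 : ℝ) = 2 ^ 2 by norm_num, Real.log_pow]
    norm_num
  linarith [Real.log_two_lt_d9]

/-- The union bound is applied to outer measures, so neither event has to be measurable. -/
theorem one_sub_le_measureReal {Ω : Type*} [MeasurableSpace Ω] {μ : Measure Ω}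
    [IsProbabilityMeasure μ] {good bad : Set Ω} {δ : ℝ} (hδ : 0 ≤ δ)
    (hbad : μ bad ≤ ENNReal.ofReal δ) (h : ∀ ω, ω ∉ bad → ω ∈ good) : 1 - δ ≤ μ.real good := by
  have h1 : μ.real bad ≤ δ := ENNReal.toReal_le_of_le_ofReal hδ hbad
  have h2 : good ∪ bad = Set.univ := by
    ext ω
    simpa [or_iff_not_imp_right] using h ω
  have h3 := measureReal_union_le (μ := μ) good bad
  rw [h2, probReal_univ] at h3
  linarith

/-- Where the majority vote of three classifiers errs, one of the last two errs. -/
theorem risk_majority_le {X : Type*} [MeasurableSpace X] {P : Measure (X × Bool)}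
    [IsFiniteMeasure P] (f₁ f₂ f₃ : X → Bool) :
    risk P (fun x => majority (f₁ x) (f₂ x) (f₃ x)) ≤ risk P f₂ + risk P f₃ := by
  refine (measureReal_mono fun z hz => ?_).trans (measureReal_union_le _ _)
  by_contra h
  simp only [Set.mem_union, Set.mem_ofPred_eq, not_or, not_not] at h
  refine hz ?_
  simp only [h.1, h.2]
  cases f₁ z.1 <;> cases z.2 <;> rfl

variable {X σ : Type*} [LinearOrder X] [MeasurableSpace X] {F : Set (X → Bool)} {k : ℕ}
  {A : OnlineLearner X σ} {P : Measure (X × Bool)}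

/-- A learner that never errs predicts every label correctly from its initial state. -/
theorem risk_fhat_eq_zero (hA : A.Conservative) (h0 : A.MistakeBound F 0) {f : X → Bool}
    (hfF : f ∈ F) (hf : ∀ᵐ z ∂P, z.2 = f z.1) {n : ℕ} {S : Fin n → X × Bool}
    (hS : LabelledBy f S) : risk P (fhat A S) = 0 := by
  have hM (T : Finset (X × Bool)) (hT : SetLabelledBy f T) : mistakeSet A T = ∅ :=
    Finset.card_eq_zero.1 (Nat.le_zero.1 (card_mistakeSet_le h0 hfF hT))
  have hempty : SetLabelledBy f (∅ : Finset (X × Bool)) := by simp [SetLabelledBy]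
  -- The compression set is empty, so that `f̂` does not depend on the sample; in particular it
  -- agrees with the classifier obtained from the sample `{(x, f x)}`, which is correct at `x`.
  have hfh : fhat A S = f := by
    funext x
    have hx : SetLabelledBy f {(x, f x)} := by simp [SetLabelledBy]
    rw [fhat_eq_fhatSet, ← hS.sampleSet.fhatSet_mistakeSet hA, hM _ hS.sampleSet, ← hM _ hx,
      hx.fhatSet_mistakeSet hA]
    exact hx.fhatSet_eq A (z := (x, f x)) (Finset.mem_singleton_self _)
  rw [hfh, risk, measureReal_def, measure_eq_zero_iff_ae_notMem.2, ENNReal.toReal_zero]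
  filter_upwards [hf] with z hz
  simp [hz]

variable [IsProbabilityMeasure P]

theorem measure_risk_fhat_gt_le (hle : MeasurableSet {p : X × X | p.1 ≤ p.2})
    (hm : A.IsMeasurable) (hA : A.Conservative) (hk : A.MistakeBound F k) (hk1 : 1 ≤ k)
    (hP : Realizable F P) {n : ℕ} (hn : 1 ≤ n) {δ ε : ℝ} (hδ : 0 < δ) (hδ1 : δ ≤ 1)
    (hε : 4 * (k * Real.log 4 + Real.log (1 / δ)) ≤ ε * n) :
    (Measure.pi fun _ : Fin n => P) {S | ε < risk P (fhat A S)} ≤ ENNReal.ofReal δ := by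
  obtain ⟨f, hfF, hf⟩ := hP
  refine measure_risk_gt_le_of_stable hf hk1 (fun ι _ => measurable_fhatSet hle hm ι)
    (fun T hT => ⟨mistakeSet A T, mistakeSet_subset A T, card_mistakeSet_le hk hfF hT,
      fun T' h h' => ?_⟩) (fun T hT z hz => hT.fhatSet_eq A hz) hn hδ hδ1 hε
  rw [← (hT.mono h').fhatSet_mistakeSet hA, mistakeSet_eq_of_subset hA h h',
    hT.fhatSet_mistakeSet hA]

theorem one_sub_le_measureReal_risk_fhat (hle : MeasurableSet {p : X × X | p.1 ≤ p.2})
    (hm : A.IsMeasurable) (hA : A.Conservative) (hk : A.MistakeBound F k) (hP : Realizable F P)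
    {n : ℕ} (hn : 1 ≤ n) {δ : ℝ} (hδ : 0 < δ) (hδ1 : δ < 1) :
    1 - δ ≤ (Measure.pi fun _ : Fin n => P).real
      {S | risk P (fhat A S) ≤ 12 * (k * tlog (1 / δ) / n)} := by
  have hnR : (0 : ℝ) < n := by exact_mod_cast hn
  rcases Nat.eq_zero_or_pos k with rfl | hk1
  · obtain ⟨f, hfF, hf⟩ := hP
    have hae : ∀ᵐ S ∂(Measure.pi fun _ : Fin n => P), LabelledBy f S :=
      ae_all_iff.2 fun i => (Measure.quasiMeasurePreserving_eval (fun _ : Fin n => P) i).ae hf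
    refine one_sub_le_measureReal (bad := {S | ¬ LabelledBy f S}) hδ.le
      ((ae_iff.1 hae).trans_le zero_le) fun S hS => ?_
    have := risk_fhat_eq_zero hA hk hfF hf (not_not.1 hS)
    simp [this]
  · refine one_sub_le_measureReal hδ.le
      (measure_risk_fhat_gt_le hle hm hA hk hk1 hP hn hδ hδ1.le
        (ε := 12 * (k * tlog (1 / δ) / n)) ?_) fun S hS =>
        (not_lt.1 hS : risk P (fhat A S) ≤ _)
    have h1 := one_le_tlog (1 / δ)
    have h2 := log_le_tlog (one_div_pos.2 hδ)
    have hkR : (1 : ℝ) ≤ k := by exact_mod_cast hk1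
    have h3 : (k : ℝ) * Real.log 4 ≤ k * (2 * tlog (1 / δ)) := by
      gcongr
      linarith [log_four_le_two]
    have h4 : tlog (1 / δ) ≤ k * tlog (1 / δ) := le_mul_of_one_le_left (by linarith) hkR
    have h5 : 12 * (k * tlog (1 / δ) / n) * n = 12 * (k * tlog (1 / δ)) := by
      field_simp
    rw [h5]
    linarith

theorem one_sub_le_measureReal_risk_ghat (hle : MeasurableSet {p : X × X | p.1 ≤ p.2})
    (hm : A.IsMeasurable) (hA : A.Conservative) (hk : A.MistakeBound F k) (hP : Realizable F P)
    {n : ℕ} (hn : 1 ≤ n) {δ : ℝ} (hδ : 0 < δ) (hδ1 : δ < 1) :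
    1 - δ ≤ (Measure.pi fun _ : Fin n => P).real
      {S | risk P (ghat A S) ≤ 96 * (k * tlog k / n + tlog (1 / δ) / n)} := by
  have hnR : (0 : ℝ) < n := by exact_mod_cast hn
  have hL := one_le_tlog (1 / δ)
  have hkk : (k : ℝ) ≤ k * tlog k := le_mul_of_one_le_right (Nat.cast_nonneg k) (one_le_tlog k)
  have hk0 : (0 : ℝ) ≤ k := Nat.cast_nonneg k
  rcases Nat.lt_or_ge n 2 with hn2 | hn2
  · -- For a single example the bound exceeds `1`.
    obtain rfl : n = 1 := by omega
    refine one_sub_le_measureReal (bad := ∅) hδ.le (by simp) fun S _ => ?_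
    refine (risk_le_one _).trans ?_
    simp only [Nat.cast_one, div_one]
    linarith
  -- Each of the last two classifiers is controlled with confidence `1 - δ / 2`; the mistake bound
  -- is raised to `1` if it is `0`.
  set K := max k 1 with hKdef
  have hK : A.MistakeBound F K := fun f hf xs => (hk f hf xs).trans (le_max_left _ _)
  have hKR : (K : ℝ) ≤ k + 1 := by
    have : K ≤ k + 1 := by omega
    exact_mod_cast this
  set ε : ℝ := 48 * (k * tlog k / n + tlog (1 / δ) / n) with hεdef
  have hεn : ε * n = 48 * (k * tlog k + tlog (1 / δ)) := by
    rw [hεdef]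
    field_simp
  have hε0 : 0 ≤ ε := by
    by_contra h
    nlinarith
  have hsize (m : ℕ) (hmn : n ≤ 3 * m) :
      4 * (K * Real.log 4 + Real.log (1 / (δ / 2))) ≤ ε * m := by
    have h1 : Real.log (1 / (δ / 2)) ≤ 1 + tlog (1 / δ) := by
      rw [show 1 / (δ / 2) = 2 * (1 / δ) by field_simp,
        Real.log_mul (by norm_num) (one_div_pos.2 hδ).ne']
      linarith [log_le_tlog (one_div_pos.2 hδ), Real.log_two_lt_d9]
    have h2 : (K : ℝ) * Real.log 4 ≤ (k + 1) * 2 := by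
      have := log_four_le_two
      gcongr
    have h3 : (n : ℝ) ≤ 3 * m := by exact_mod_cast hmn
    have h4 : ε * n ≤ ε * (3 * m) := by gcongr
    linarith
  have hδ2 : 0 < δ / 2 := by linarith
  have hδ21 : δ / 2 ≤ 1 := by linarith
  have hbad₂ : (Measure.pi fun _ : Fin n => P)
      {S | ε < risk P (fhat A (initialPart S (2 * n / 3) (by omega)))}
      ≤ ENNReal.ofReal (δ / 2) :=
    ((measurePreserving_comp_injective (P := P) (e := Fin.castLE (by omega : 2 * n / 3 ≤ n))
      (Fin.castLE_injective _)).measure_preimage_le _).trans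
      (measure_risk_fhat_gt_le hle hm hA hK (le_max_right _ _) hP (by omega) hδ2 hδ21
        (hsize _ (by omega)))
  have hbad₃ : (Measure.pi fun _ : Fin n => P) {S | ε < risk P (fhat A S)}
      ≤ ENNReal.ofReal (δ / 2) :=
    measure_risk_fhat_gt_le hle hm hA hK (le_max_right _ _) hP hn hδ2 hδ21 (hsize _ (by omega))
  refine one_sub_le_measureReal hδ.le ((measure_union_le _ _).trans
    ((add_le_add hbad₂ hbad₃).trans_eq ?_)) fun S hS => ?_
  · rw [← ENNReal.ofReal_add hδ2.le hδ2.le, add_halves]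
  · simp only [Set.mem_union, Set.mem_ofPred_eq, not_or, not_lt] at hS
    have h := risk_majority_le (P := P) (fhat A (initialPart S (n / 3) (by omega)))
      (fhat A (initialPart S (2 * n / 3) (by omega))) (fhat A S)
    change risk P (ghat A S) ≤ _ at h
    change risk P (ghat A S) ≤ _
    linarith [hS.1, hS.2]

end Rates

end OnlineToBatch

theorem mainTheorem9 :
    -- `f̂` is the output of a stable sample compression scheme of size `k`
    (∀ (X : Type u) (σ : Type v) [LinearOrder X] (F : Set (X → Bool)) (k : ℕ)
        (A : OnlineToBatch.OnlineLearner X σ),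
      A.Conservative → A.MistakeBound F k →
      ∃ (κ : (n : ℕ) → (Fin n → X × Bool) → Finset (X × Bool))
        (ρ : Finset (X × Bool) → X → Bool),
        OnlineToBatch.IsStableCompressionScheme F k κ ρ ∧
        ∀ (n : ℕ), ∀ f ∈ F, ∀ S : Fin n → X × Bool, OnlineToBatch.LabelledBy f S →
          OnlineToBatch.fhat A S = ρ (κ n S)) ∧
    -- the rate of `f̂`
    (∃ c : ℝ, 0 < c ∧
      ∀ (X : Type u) (σ : Type v) [LinearOrder X] [MeasurableSpace X] (F : Set (X → Bool)) (k : ℕ)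
        (A : OnlineToBatch.OnlineLearner X σ),
      MeasurableSet {p : X × X | p.1 ≤ p.2} → (∀ f ∈ F, Measurable f) → A.IsMeasurable →
      A.Conservative → A.MistakeBound F k →
      ∀ (P : MeasureTheory.Measure (X × Bool)) [MeasureTheory.IsProbabilityMeasure P],
      OnlineToBatch.Realizable F P →
      ∀ (n : ℕ), 1 ≤ n → ∀ δ : ℝ, 0 < δ → δ < 1 →
        1 - δ ≤ (MeasureTheory.Measure.pi fun _ : Fin n => P).real
          {S | OnlineToBatch.risk P (OnlineToBatch.fhat A S) ≤
            c * (k * OnlineToBatch.tlog (1 / δ) / n)}) ∧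
    -- the rate of `ĝ`, when the VC dimension `d` of the output class satisfies `d ≲ k`
    (∀ C : ℝ, 0 < C → ∃ c : ℝ, 0 < c ∧
      ∀ (X : Type u) (σ : Type v) [LinearOrder X] [MeasurableSpace X] (F : Set (X → Bool)) (k : ℕ)
        (A : OnlineToBatch.OnlineLearner X σ),
      MeasurableSet {p : X × X | p.1 ≤ p.2} → (∀ f ∈ F, Measurable f) → A.IsMeasurable →
      A.Conservative → A.MistakeBound F k →
      ∀ d : ℕ, OnlineToBatch.vcDim (A.outputClass F) = d → (d : ℝ) ≤ C * k →
      ∀ (P : MeasureTheory.Measure (X × Bool)) [MeasureTheory.IsProbabilityMeasure P],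
      OnlineToBatch.Realizable F P →
      ∀ (n : ℕ), 1 ≤ n → ∀ δ : ℝ, 0 < δ → δ < 1 →
        1 - δ ≤ (MeasureTheory.Measure.pi fun _ : Fin n => P).real
          {S | OnlineToBatch.risk P (OnlineToBatch.ghat A S) ≤
            c * (k * OnlineToBatch.tlog k / n + OnlineToBatch.tlog (1 / δ) / n)}) := by
  refine ⟨fun X σ _ F k A hA hk => OnlineToBatch.exists_isStableCompressionScheme hA hk,
    ⟨12, by norm_num, ?_⟩, fun C _ => ⟨96, by norm_num, ?_⟩⟩
  · intro X σ _ _ F k A hle _ hm hA hk P _ hP n hn δ hδ hδ1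
    exact OnlineToBatch.one_sub_le_measureReal_risk_fhat hle hm hA hk hP hn hδ hδ1
  · intro X σ _ _ F k A hle _ hm hA hk d _ _ P _ hP n hn δ hδ hδ1
    exact OnlineToBatch.one_sub_le_measureReal_risk_ghat hle hm hA hk hP hn hδ hδ1
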